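/- **Lemma (Packing).** Let $p$ be a prime, $r,m\ge 1$, and for $0\le s\le r$ let $[a]_s$ be the unique element $t\in\{0,1,\dots,p^s-1\}$ with $a\in t+p^s\mathbb{Z}_{p^r}$, for $a\in\mathbb{Z}_{p^r}$. For a random variable $Z$ on a finite alphabet, $A_\epsilon^{(n)}(Z)$ denotes the set of (strongly) $\epsilon$-typical sequences of length $n$: the relative frequency of each letter differs from its probability by at most $\epsilon$ divided by the alphabet size, and no letter of probability zero occurs; $A_\epsilon^{(n)}(X,Y)$ is this set for the pair $(X,Y)$. Entropies are in bits. Let $U_1,\dots,U_m$ be random variables over $\mathbb{Z}_{p^r}$, and let $(X,Y)\sim p(x,y)$ with $X$ uniform over $\mathbb{Z}_{p^r}$ and $Y$ in a finite set. For each $n$ let $k_1,\dots,k_m$ be positive integers (which may depend on $n$) and put $k=\sum_i k_i$. Define $(Q,U)$ by $P(Q=i)=k_i/k$ and $P(U=a\mid Q=i)=P(U_i=a)$. Consider the quasi group code $$\mathcal{C}=\Big\{\sum_{i=1}^m \mathbf{u}_i\mathbf{G}_i+\mathbf{b} \;:\; \mathbf{u}_i\in A_\epsilon^{(k_i)}(U_i),\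 i=1,\dots,m\Big\},$$ where all entries of the $k_i\times n$ matrices $\mathbf{G}_i$ and of $\mathbf{b}\in\mathbb{Z}_{p^r}^n$ are independent and uniform over $\mathbb{Z}_{p^r}$; its codewords are indexed by $\theta=(\mathbf{u}_1,\dots,\mathbf{u}_m)\in\prod_i A_\epsilon^{(k_i)}(U_i)$ and $\mathbf{c}(\theta)$ is the codeword with index $\theta$. Its rate is $R=\frac{k}{n}H(U|Q)$. Fix an index $\theta$. Let $\tilde{\mathbf{Y}}^n$ have, given $\mathbf{c}(\theta)$, the law $\prod_{j=1}^n p(\tilde y_j\mid c_j(\theta))$, and suppose that, conditioned on $\mathbf{c}(\theta)$, $\tilde{\mathbf{Y}}^n$ is independent of each other codeword of $\mathcal{C}$. Suppose that for some $\delta>0$ and all sufficiently large $n$ $$R+\delta\le\min_{0\le s\le r-1}\frac{H(U|Q)}{H(U|Q,[U]_s)}\Big(\log_2p^{r-s}-H(X|Y,[X]_s)\Big),$$ where the indices $s$ with $H(U|Q,[U]_s)=0$ are left out of the minimum (when $R$ and the law of $Q$ do not depend on $n$, this says that $R$ is strictly less than the minimum). Then for all sufficiently small $\epsilon>0$, $$P\big\{\exists\,\mathbf{x}\in\mathcal{C}:\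 (\mathbf{x},\tilde{\mathbf{Y}}^n)\in A_\epsilon^{(n)}(X,Y),\ \mathbf{x}\ne\mathbf{c}(\theta)\big\}\to 0\qquad(n\to\infty),$$ uniformly in the index $\theta$. -/

import Mathlib

open Filter

/-! Finite mass functions and entropy in bits. -/

/-- The mass that the law of `f` gives to `b`, when the underlying point has mass function `P`. -/
noncomputable def marginal {α β : Type*} [Fintype α] (P : α → ℝ) (f : α → β) (b : β) : ℝ :=
  open Classical in ∑ a, if f a = b then P a else 0

/-- The conditional entropy `H(f | g) = - E[log₂ P(f | g)]`, in bits; points of mass zero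
contribute zero. -/
noncomputable def condEntropy {α β γ : Type*} [Fintype α] (P : α → ℝ) (f : α → β) (g : α → γ) : ℝ :=
  ∑ a, P a * -Real.logb 2 (marginal P (fun z => (f z, g z)) (f a, g a) / marginal P g (g a))

/-- The probability of the event `E` under the law `J`. -/
noncomputable def prob {α : Type*} (J : PMF α) (E : Set α) : ℝ := (J.toOuterMeasure E).toReal

/-- The (strongly) `ε`-typical sequences of length `n` for the law `P` on a finite alphabet: every
empirical frequency is within `ε / |α|` of its probability, and no letter of probability zero
occurs. -/
def typicalSet {α : Type*} [Fintype α] (P : PMF α) (ε : ℝ) (n : ℕ) : Set (Fin n → α) :=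
  {x | ∀ a, |(Nat.card {j // x j = a} : ℝ) / n - (P a).toReal| ≤ ε / Fintype.card α ∧
    (P a = 0 → ∀ j, x j ≠ a)}

/-- `[a]_s`: the unique `t ∈ {0, 1, …, p ^ s - 1}` with `a ∈ t + p ^ s ℤ_{p ^ r}`, for `s ≤ r`. -/
def lowPart {p r : ℕ} (s : ℕ) (a : ZMod (p ^ r)) : ZMod (p ^ r) := ((a.val % p ^ s : ℕ) : ZMod (p ^ r))

/-! Quasi group codes. Below `m` is the number of layers and `k i` the length of the `i`-th layer. -/

/-- Input tuples `(u_1, …, u_m)`, with `u_i` of length `k i`. -/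
abbrev Inputs (p r : ℕ) {m : ℕ} (k : Fin m → ℕ) : Type := ∀ i, Fin (k i) → ZMod (p ^ r)

/-- Tuples `(G_1, …, G_m)` of generator matrices, with `G_i` of size `k i × n`. -/
abbrev Generators (p r n : ℕ) {m : ℕ} (k : Fin m → ℕ) : Type :=
  ∀ i, Matrix (Fin (k i)) (Fin n) (ZMod (p ^ r))

/-- The product of the typical sets of `U_1, …, U_m`. -/
def inputSet {p r m : ℕ} [NeZero p] (U : Fin m → PMF (ZMod (p ^ r))) (ε : ℝ) (k : Fin m → ℕ) :
    Set (Inputs p r k) :=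
  {u | ∀ i, u i ∈ typicalSet (U i) ε (k i)}

/-- The codeword `∑ i, u_i G_i + b`. -/
def codeword {p r n m : ℕ} {k : Fin m → ℕ} (G : Generators p r n k) (b : Fin n → ZMod (p ^ r))
    (u : Inputs p r k) : Fin n → ZMod (p ^ r) :=
  (∑ i, Matrix.vecMul (u i) (G i)) + b

/-- The quasi group code with random variables `U`, generator matrices `G` and translation `b`. -/
def qgc {p r n m : ℕ} [NeZero p] {k : Fin m → ℕ} (U : Fin m → PMF (ZMod (p ^ r))) (ε : ℝ)
    (G : Generators p r n k) (b : Fin n → ZMod (p ^ r)) : Set (Fin n → ZMod (p ^ r)) :=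
  codeword G b '' inputSet U ε k

/-- The joint mass function of `(Q, U)`: `P(Q = i) = k_i / ∑ k` and `P(U = a | Q = i) = P(U_i = a)`. -/
noncomputable def layerMass {p r m : ℕ} (U : Fin m → PMF (ZMod (p ^ r))) (k : Fin m → ℕ) :
    Fin m × ZMod (p ^ r) → ℝ :=
  fun z => (k z.1 : ℝ) / (∑ i, k i : ℕ) * (U z.1 z.2).toReal

/-- `H(U | Q)`. -/
noncomputable def entropyUQ {p r m : ℕ} [NeZero p] (U : Fin m → PMF (ZMod (p ^ r)))
    (k : Fin m → ℕ) : ℝ :=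
  condEntropy (layerMass U k) (fun z => z.2) (fun z => z.1)

/-- `H(U | Q, [U]_s)`. -/
noncomputable def entropyUQs {p r m : ℕ} [NeZero p] (U : Fin m → PMF (ZMod (p ^ r)))
    (k : Fin m → ℕ) (s : ℕ) : ℝ :=
  condEntropy (layerMass U k) (fun z => z.2) (fun z => (z.1, lowPart s z.2))

/-- `H(X | Y, [X]_s)`. -/
noncomputable def entropyXYs {p r : ℕ} [NeZero p] {𝒴 : Type*} [Fintype 𝒴]
    (P : PMF (ZMod (p ^ r) × 𝒴)) (s : ℕ) : ℝ :=
  condEntropy (fun z => (P z).toReal) (fun z => z.1) (fun z => (z.2, lowPart s z.1))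

/-- The rate `R = (k / n) H(U | Q)` with `k = ∑ i, k_i`. -/
noncomputable def rate {p r m : ℕ} [NeZero p] (U : Fin m → PMF (ZMod (p ^ r))) (k : Fin m → ℕ)
    (n : ℕ) : ℝ :=
  (∑ i, k i : ℕ) / (n : ℝ) * entropyUQ U k

/-- The channel `p(y | x)` of the joint law `P`. -/
noncomputable def channel {α 𝒴 : Type*} [Fintype 𝒴] (P : PMF (α × 𝒴)) (x : α) (y : 𝒴) : ℝ :=
  (P (x, y)).toReal / ∑ y', (P (x, y')).toReal

/-- The outcome of code selection and transmission: generator matrices, translation and channel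
output. -/
abbrev Outcome (p r n : ℕ) {m : ℕ} (k : Fin m → ℕ) (𝒴 : Type*) :=
  (Generators p r n k × (Fin n → ZMod (p ^ r))) × (Fin n → 𝒴)

/-- The codeword with index `u`, as a random variable. -/
def randCodeword {p r n m : ℕ} {k : Fin m → ℕ} {𝒴 : Type*} (u : Inputs p r k)
    (ω : Outcome p r n k 𝒴) : Fin n → ZMod (p ^ r) :=
  codeword ω.1.1 ω.1.2 u

/-- `J` is a joint law of the generator matrices, the translation and the channel output when the
codeword with index `u₀` is sent over the memoryless channel of `P`. -/
structure IsTransmission {p r n m : ℕ} [NeZero p] {k : Fin m → ℕ} {𝒴 : Type*} [Fintype 𝒴]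
    (U : Fin m → PMF (ZMod (p ^ r))) (P : PMF (ZMod (p ^ r) × 𝒴)) (ε : ℝ) (u₀ : Inputs p r k)
    (J : PMF (Outcome p r n k 𝒴)) : Prop where
  /-- All entries of the matrices and of the translation are independent and uniform. -/
  uniform : J.map Prod.fst = PMF.uniformOfFintype (Generators p r n k × (Fin n → ZMod (p ^ r)))
  /-- Given the sent codeword, the output has the product law `∏ j, p(y_j | c_j)`. -/
  output : ∀ x₀ y, prob J {ω | randCodeword u₀ ω = x₀ ∧ ω.2 = y} =
    prob J {ω | randCodeword u₀ ω = x₀} * ∏ j, channel P (x₀ j) (y j)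
  /-- Given the sent codeword, the output is independent of each other codeword. -/
  indep : ∀ u ∈ inputSet U ε k, u ≠ u₀ → ∀ x₀ x y,
    prob J {ω | randCodeword u₀ ω = x₀ ∧ randCodeword u ω = x ∧ ω.2 = y} *
        prob J {ω | randCodeword u₀ ω = x₀} =
      prob J {ω | randCodeword u₀ ω = x₀ ∧ randCodeword u ω = x} *
        prob J {ω | randCodeword u₀ ω = x₀ ∧ ω.2 = y}

/-- Some codeword other than the one sent is jointly typical with the channel output. -/
def confusionEvent {p r n m : ℕ} [NeZero p] {k : Fin m → ℕ} {𝒴 : Type*} [Fintype 𝒴]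
    (U : Fin m → PMF (ZMod (p ^ r))) (P : PMF (ZMod (p ^ r) × 𝒴)) (ε : ℝ) (u₀ : Inputs p r k) :
    Set (Outcome p r n k 𝒴) :=
  {ω | ∃ x ∈ qgc U ε ω.1.1 ω.1.2,
    (fun j => (x j, ω.2 j)) ∈ typicalSet P ε n ∧ x ≠ randCodeword u₀ ω}

/-!
The proof is a union bound over the inputs `u ≠ u₀`, grouped by the largest level `s < r` at which
`u` and `u₀` agree modulo `p ^ s`.

At level `s` there are at most `2 ^ ((1 + D ε) k H(U | Q, [U]_s))` inputs, by conditional typicality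
in each layer (`card_typicalSet_fiber_le`, `card_inputSet_fiber_le`). For such an input, some
coordinate of `u - u₀` has valuation exactly `s`, so that, given the codeword `x₀` of `u₀`, the
codeword of `u` takes each value with probability at most `p ^ (-(r - s) n)` (`card_codes_mul_le`),
and it agrees with `x₀` modulo `p ^ s`. Given `x₀` and the output `y`, at most
`2 ^ ((1 + D ε) n H(X | Y, [X]_s))` words of this kind are jointly typical with `y`. Thus the level
contributes at most `2 ^ E`, where with `L_s = log₂ p ^ (r - s) - H(X | Y, [X]_s)`
`E = (1 + D ε) k H(U | Q, [U]_s) + (1 + D ε) n H(X | Y, [X]_s) - n log₂ p ^ (r - s)`.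

It remains to see that `E ≤ -n σ` with `σ` independent of `n`. The law of `Q` depends on `n`, and
the ratio `ρ = H(U | Q, [U]_s) / H(U | Q)` may tend to zero, so the slack `δ ρ` that the rate
condition offers directly is not bounded below. But the condition at `s = 0` bounds the rate `R`,
and `L_s ≥ ρ (R + δ)` then makes `ρ R` smaller than `L_s` by a constant factor (`rate_slack`,
`exists_linear_slack`). The errors of typicality are relative: `D` is an upper bound for the
reciprocals of the positive masses. This keeps them under control although `k / n` need not be
bounded, and it shows that a level with `H(U | Q, [U]_s) = 0` contains no input but `u₀`
(`card_competitors_add_one_le`).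
-/

/-! ### Typical averages -/

lemma exists_one_le_mul_mass {α : Type*} [Fintype α] (P : PMF α) :
    ∃ D : ℝ, 0 ≤ D ∧ ∀ a, P a ≠ 0 → 1 ≤ D * (P a).toReal := by
  refine ⟨∑ a, (P a).toReal⁻¹, Finset.sum_nonneg fun a _ => by positivity, fun a ha => ?_⟩
  have hpos : 0 < (P a).toReal := ENNReal.toReal_pos ha (P.apply_ne_top a)
  have hle : (P a).toReal⁻¹ ≤ ∑ a, (P a).toReal⁻¹ :=
    Finset.single_le_sum (f := fun a => (P a).toReal⁻¹) (fun b _ => by positivity)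
      (Finset.mem_univ a)
  calc (1 : ℝ) = (P a).toReal⁻¹ * (P a).toReal := (inv_mul_cancel₀ hpos.ne').symm
    _ ≤ _ := mul_le_mul_of_nonneg_right hle hpos.le

/-- The average of a nonnegative function along a typical sequence exceeds its mean by at most the
relative error `D ε`; letters of mass zero do not matter because they do not occur. -/
lemma sum_le_of_mem_typicalSet {α : Type*} [Fintype α] {P : PMF α} {D ε : ℝ} (hε : 0 ≤ ε)
    (hD : ∀ a, P a ≠ 0 → 1 ≤ D * (P a).toReal) {n : ℕ} (hn : 0 < n) {x : Fin n → α}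
    (hx : x ∈ typicalSet P ε n) {c : α → ℝ} (hc : ∀ a, 0 ≤ c a) :
    ∑ j, c (x j) ≤ n * (1 + D * ε) * ∑ a, (P a).toReal * c a := by
  classical
  have hn' : (0 : ℝ) < n := by exact_mod_cast hn
  have hfib : ∑ j, c (x j) = ∑ a, (Nat.card {j // x j = a} : ℝ) * c a := by
    rw [← Finset.sum_fiberwise Finset.univ x]
    refine Finset.sum_congr rfl fun a _ => ?_
    rw [Finset.sum_congr rfl (g := fun _ => c a)
      (fun j hj => by rw [(Finset.mem_filter.1 hj).2]), Finset.sum_const, nsmul_eq_mul,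
      Nat.card_eq_fintype_card, Fintype.card_subtype]
  rw [hfib, Finset.mul_sum]
  refine Finset.sum_le_sum fun a _ => ?_
  rw [← mul_assoc]
  refine mul_le_mul_of_nonneg_right ?_ (hc a)
  obtain ⟨hfreq, hzero⟩ := hx a
  by_cases ha : P a = 0
  · have : IsEmpty {j // x j = a} := ⟨fun j => hzero ha j.1 j.2⟩
    simp [ha]
  · have hcard : (1 : ℝ) ≤ Fintype.card α := by
      have : Nonempty α := ⟨a⟩
      exact_mod_cast Fintype.card_pos
    have h1 : ε / Fintype.card α ≤ ε := div_le_self hε hcard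
    have h2 : ε ≤ D * ε * (P a).toReal := by nlinarith [hD a ha]
    have h3 : (Nat.card {j // x j = a} : ℝ) / n ≤ (1 + D * ε) * (P a).toReal := by
      linarith [(abs_le.1 hfreq).2]
    rw [div_le_iff₀ hn'] at h3
    linarith

lemma exists_uniform_mass_bound {p r m : ℕ} [NeZero p] {𝒴 : Type*} [Fintype 𝒴]
    (U : Fin m → PMF (ZMod (p ^ r))) (P : PMF (ZMod (p ^ r) × 𝒴)) :
    ∃ D : ℝ, 0 ≤ D ∧ (∀ i a, U i a ≠ 0 → 1 ≤ D * (U i a).toReal) ∧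
      ∀ z, P z ≠ 0 → 1 ≤ D * (P z).toReal := by
  choose C hC0 hC using fun i => exists_one_le_mul_mass (U i)
  obtain ⟨B, hB0, hB⟩ := exists_one_le_mul_mass P
  have hsum : 0 ≤ ∑ i, C i := Finset.sum_nonneg fun i _ => hC0 i
  refine ⟨∑ i, C i + B, by positivity, fun i a ha => ?_, fun z hz => ?_⟩
  · have hi : C i ≤ ∑ i, C i := Finset.single_le_sum (fun j _ => hC0 j) (Finset.mem_univ i)
    exact (hC i a ha).trans (mul_le_mul_of_nonneg_right (by linarith) ENNReal.toReal_nonneg)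
  · exact (hB z hz).trans (mul_le_mul_of_nonneg_right (by linarith) ENNReal.toReal_nonneg)

/-! ### Marginals and conditional entropy -/

lemma marginal_nonneg {α β : Type*} [Fintype α] {P : α → ℝ} (hP : ∀ a, 0 ≤ P a) (f : α → β)
    (b : β) : 0 ≤ marginal P f b :=
  Finset.sum_nonneg fun a _ => by split_ifs <;> simp [hP a]

lemma le_marginal {α β : Type*} [Fintype α] {P : α → ℝ} (hP : ∀ a, 0 ≤ P a) (f : α → β) (a : α) :
    P a ≤ marginal P f (f a) := by
  classical
  have h := Finset.single_le_sum (f := fun b => if f b = f a then P b else 0)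
    (fun b _ => by split_ifs <;> simp [hP b]) (Finset.mem_univ a)
  simpa [marginal] using h

lemma marginal_apply_of_injective {α β : Type*} [Fintype α] (P : α → ℝ) {f : α → β}
    (hf : Function.Injective f) (a : α) : marginal P f (f a) = P a := by
  classical
  simp [marginal, hf.eq_iff]

lemma marginal_congr {α β γ : Type*} [Fintype α] (P : α → ℝ) {f : α → β} {g : α → γ} {b : β}
    {c : γ} (h : ∀ a, f a = b ↔ g a = c) : marginal P f b = marginal P g c := by
  classical
  exact Finset.sum_congr rfl fun a _ => by by_cases hc : g a = c <;> simp [hc, h a]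

/-- If `(f, g)` determines the point, then `H(f | g)` is the entropy of the point given `g`. -/
lemma condEntropy_eq_of_injective {α β γ : Type*} [Fintype α] (P : α → ℝ) {f : α → β} {g : α → γ}
    (h : Function.Injective fun a => (f a, g a)) :
    condEntropy P f g = ∑ a, P a * -Real.logb 2 (P a / marginal P g (g a)) := by
  refine Finset.sum_congr rfl fun a _ => ?_
  rw [marginal_apply_of_injective P h a]

lemma condEntropy_nonneg {α β γ : Type*} [Fintype α] {P : α → ℝ} (hP : ∀ a, 0 ≤ P a) {f : α → β}
    {g : α → γ} (h : Function.Injective fun a => (f a, g a)) : 0 ≤ condEntropy P f g := by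
  rw [condEntropy_eq_of_injective P h]
  refine Finset.sum_nonneg fun a _ => mul_nonneg (hP a) (neg_nonneg.2 ?_)
  exact Real.logb_nonpos one_lt_two (div_nonneg (hP a) (marginal_nonneg hP _ _))
    (div_le_one_of_le₀ (le_marginal hP g a) (marginal_nonneg hP _ _))

lemma sum_conditional_le_one {α γ : Type*} [Fintype α] [DecidableEq γ] (P : α → ℝ)
    (g : α → γ) (c : γ) :
    ∑ a with g a = c, P a / marginal P g (g a) ≤ 1 := by
  have hm : marginal P g c = ∑ a with g a = c, P a := by
    rw [Finset.sum_filter]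
    refine Finset.sum_congr rfl fun a _ => ?_
    congr
  rw [Finset.sum_congr rfl (g := fun a => P a / marginal P g c)
    (fun a ha => by rw [(Finset.mem_filter.1 ha).2]), ← Finset.sum_div, ← hm]
  exact div_self_le_one _

/-! ### Conditional typicality -/

/-- Conditional typicality: at most `2 ^ (n (1 + D ε) H(x | g))` typical sequences have a given
image under `g`, where `1 / D` bounds the positive masses from below. The relative error `D ε`
makes the bound equal to `1` when the conditional entropy vanishes. -/
lemma card_typicalSet_fiber_le {α β γ : Type*} [Fintype α] {P : PMF α} {D ε : ℝ} (hε : 0 ≤ ε)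
    (hD : ∀ a, P a ≠ 0 → 1 ≤ D * (P a).toReal) {n : ℕ} (hn : 0 < n) {f : α → β} {g : α → γ}
    (h : Function.Injective fun a => (f a, g a)) (w : Fin n → γ) :
    (Nat.card {x // x ∈ typicalSet P ε n ∧ ∀ j, g (x j) = w j} : ℝ) ≤
      (2 : ℝ) ^ (n * (1 + D * ε) * condEntropy (fun a => (P a).toReal) f g) := by
  classical
  set p : α → ℝ := fun a => (P a).toReal with hp
  have hp0 : ∀ a, 0 ≤ p a := fun a => ENNReal.toReal_nonneg
  set q : α → ℝ := fun a => p a / marginal p g (g a) with hq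
  have hq0 : ∀ a, 0 ≤ q a := fun a => div_nonneg (hp0 a) (marginal_nonneg hp0 _ _)
  have hq1 : ∀ a, q a ≤ 1 := fun a =>
    div_le_one_of_le₀ (le_marginal hp0 g a) (marginal_nonneg hp0 _ _)
  set E := (n : ℝ) * (1 + D * ε) * condEntropy p f g with hE
  -- every typical sequence has conditional probability at least `2 ^ (-E)`
  have hlow : ∀ x ∈ typicalSet P ε n, (2 : ℝ) ^ (-E) ≤ ∏ j, q (x j) := by
    intro x hx
    have hqpos : ∀ j, 0 < q (x j) := by
      intro j
      have hne : P (x j) ≠ 0 := fun h0 => (hx (x j)).2 h0 j rfl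
      have : 0 < p (x j) := ENNReal.toReal_pos hne (P.apply_ne_top _)
      exact div_pos this (this.trans_le (le_marginal hp0 g _))
    have hsum := sum_le_of_mem_typicalSet hε hD hn hx (c := fun a => -Real.logb 2 (q a))
      (fun a => neg_nonneg.2 (Real.logb_nonpos one_lt_two (hq0 a) (hq1 a)))
    rw [← Real.le_logb_iff_rpow_le one_lt_two (Finset.prod_pos fun j _ => hqpos j),
      Real.logb_prod _ _ (fun j _ => (hqpos j).ne'), hE, condEntropy_eq_of_injective p h]
    rw [Finset.sum_neg_distrib] at hsum
    linarith
  -- the conditional probabilities of the sequences over `w` add up to at most one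
  have htot : ∑ x ∈ Fintype.piFinset fun j => Finset.univ.filter fun a => g a = w j,
      ∏ j, q (x j) ≤ 1 := by
    rw [← Finset.prod_univ_sum]
    exact Finset.prod_le_one (fun j _ => Finset.sum_nonneg fun a _ => hq0 a)
      fun j _ => sum_conditional_le_one p g (w j)
  have hsub : ∑ x with x ∈ typicalSet P ε n ∧ ∀ j, g (x j) = w j, ∏ j, q (x j) ≤ 1 := by
    refine (Finset.sum_le_sum_of_subset_of_nonneg ?_ fun x _ _ =>
      Finset.prod_nonneg fun j _ => hq0 _).trans htot
    intro x hx
    simpa using (Finset.mem_filter.1 hx).2.2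
  have hcard := (Finset.card_nsmul_le_sum _ _ _ fun x hx =>
    hlow x (Finset.mem_filter.1 hx).2.1).trans hsub
  rw [nsmul_eq_mul, Real.rpow_neg zero_le_two, ← div_eq_mul_inv, div_le_one (by positivity)] at hcard
  rwa [Nat.card_eq_fintype_card, Fintype.card_subtype]

/-! ### Entropies of the layers and of the channel -/

lemma marginal_layerMass {p r m : ℕ} [NeZero p] (U : Fin m → PMF (ZMod (p ^ r)))
    (k : Fin m → ℕ) {γ : Type*} (g : ZMod (p ^ r) → γ) (i : Fin m) (c : γ) :
    marginal (layerMass U k) (fun z => (z.1, g z.2)) (i, c) =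
      (k i : ℝ) / (∑ i, k i : ℕ) * marginal (fun a => (U i a).toReal) g c := by
  classical
  unfold marginal
  rw [Fintype.sum_prod_type, Finset.sum_eq_single i]
  · rw [Finset.mul_sum]
    refine Finset.sum_congr rfl fun a _ => ?_
    by_cases h : g a = c <;> simp [h, layerMass]
  · intro b _ hb
    exact Finset.sum_eq_zero fun a _ => by simp [hb]
  · simp

/-- `k H(U | Q, [U]_s)` is the sum of the entropies `k_i H(U_i | [U_i]_s)` of the layers. -/
lemma sum_mul_entropyUQs {p r m : ℕ} [NeZero p] (U : Fin m → PMF (ZMod (p ^ r)))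
    {k : Fin m → ℕ} (hk : ∀ i, 0 < k i) (s : ℕ) :
    ((∑ i, k i : ℕ) : ℝ) * entropyUQs U k s =
      ∑ i, (k i : ℝ) * condEntropy (fun a => (U i a).toReal) (fun a => a) (lowPart s) := by
  have hinj : Function.Injective fun z : Fin m × ZMod (p ^ r) => (z.2, (z.1, lowPart s z.2)) := by
    rintro ⟨i, a⟩ ⟨j, b⟩ h
    simp only [Prod.mk.injEq] at h
    exact Prod.ext h.2.1 h.1
  rw [entropyUQs, condEntropy_eq_of_injective _ hinj, Fintype.sum_prod_type, Finset.mul_sum]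
  refine Finset.sum_congr rfl fun i _ => ?_
  rw [condEntropy_eq_of_injective _ (fun a b h => (Prod.mk.inj h).1), Finset.mul_sum,
    Finset.mul_sum]
  refine Finset.sum_congr rfl fun a _ => ?_
  have hki : (k i : ℝ) ≠ 0 := by exact_mod_cast (hk i).ne'
  have hK : ((∑ i, k i : ℕ) : ℝ) ≠ 0 := by
    have : k i ≤ ∑ i, k i := Finset.single_le_sum (fun _ _ => Nat.zero_le _) (Finset.mem_univ i)
    exact_mod_cast ((hk i).trans_le this).ne'
  rw [marginal_layerMass U k (lowPart s) i, layerMass, mul_div_mul_left _ _ (div_ne_zero hki hK),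
    ← mul_assoc, ← mul_assoc, mul_div_cancel₀ _ hK, mul_assoc]

lemma layerMass_nonneg {p r m : ℕ} (U : Fin m → PMF (ZMod (p ^ r))) (k : Fin m → ℕ)
    (z : Fin m × ZMod (p ^ r)) : 0 ≤ layerMass U k z := by
  unfold layerMass
  positivity

lemma entropyUQ_nonneg {p r m : ℕ} [NeZero p] (U : Fin m → PMF (ZMod (p ^ r)))
    (k : Fin m → ℕ) : 0 ≤ entropyUQ U k :=
  condEntropy_nonneg (layerMass_nonneg U k) fun _ _ h => Prod.ext (Prod.mk.inj h).2 (Prod.mk.inj h).1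

lemma entropyUQs_nonneg {p r m : ℕ} [NeZero p] (U : Fin m → PMF (ZMod (p ^ r)))
    (k : Fin m → ℕ) (s : ℕ) : 0 ≤ entropyUQs U k s :=
  condEntropy_nonneg (layerMass_nonneg U k) fun _ _ h =>
    Prod.ext (Prod.mk.inj (Prod.mk.inj h).2).1 (Prod.mk.inj h).1

lemma lowPart_zero {p r : ℕ} (a : ZMod (p ^ r)) : lowPart 0 a = 0 := by
  simp [lowPart, Nat.mod_one]

lemma entropyUQs_zero {p r m : ℕ} [NeZero p] (U : Fin m → PMF (ZMod (p ^ r)))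
    (k : Fin m → ℕ) : entropyUQs U k 0 = entropyUQ U k := by
  refine Finset.sum_congr rfl fun z _ => ?_
  have h₁ : marginal (layerMass U k) (fun z => (z.2, (z.1, lowPart 0 z.2)))
      (z.2, (z.1, lowPart 0 z.2)) = marginal (layerMass U k) (fun z => (z.2, z.1)) (z.2, z.1) :=
    marginal_congr _ (by simp [lowPart_zero])
  have h₂ : marginal (layerMass U k) (fun z => (z.1, lowPart 0 z.2)) (z.1, lowPart 0 z.2) =
      marginal (layerMass U k) (fun z => z.1) z.1 :=
    marginal_congr _ (by simp [lowPart_zero])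
  rw [h₁, h₂]

lemma entropyXYs_nonneg {p r : ℕ} [NeZero p] {𝒴 : Type*} [Fintype 𝒴]
    (P : PMF (ZMod (p ^ r) × 𝒴)) (s : ℕ) : 0 ≤ entropyXYs P s :=
  condEntropy_nonneg (fun _ => ENNReal.toReal_nonneg) fun _ _ h =>
    Prod.ext (Prod.mk.inj h).1 (Prod.mk.inj (Prod.mk.inj h).2).1

/-- The number of inputs with the same residues modulo `p ^ s` as `v` is at most
`2 ^ (k (1 + D ε) H(U | Q, [U]_s))`. -/
lemma card_inputSet_fiber_le {p r m : ℕ} [NeZero p] {U : Fin m → PMF (ZMod (p ^ r))} {D ε : ℝ}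
    (hε : 0 ≤ ε) (hD : ∀ i a, U i a ≠ 0 → 1 ≤ D * (U i a).toReal) {k : Fin m → ℕ}
    (hk : ∀ i, 0 < k i) (s : ℕ) (v : Inputs p r k) :
    (Nat.card {u // u ∈ inputSet U ε k ∧ ∀ i l, lowPart s (u i l) = lowPart s (v i l)} : ℝ) ≤
      (2 : ℝ) ^ ((1 + D * ε) * ((∑ i, k i : ℕ) * entropyUQs U k s)) := by
  classical
  let e : {u // u ∈ inputSet U ε k ∧ ∀ i l, lowPart s (u i l) = lowPart s (v i l)} ≃
      ∀ i, {x // x ∈ typicalSet (U i) ε (k i) ∧ ∀ l, lowPart s (x l) = lowPart s (v i l)} :=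
    { toFun := fun u i => ⟨u.1 i, u.2.1 i, u.2.2 i⟩
      invFun := fun x => ⟨fun i => (x i).1, fun i => (x i).2.1, fun i => (x i).2.2⟩
      left_inv := fun _ => rfl
      right_inv := fun _ => rfl }
  rw [Nat.card_congr e, Nat.card_pi, Nat.cast_prod, sum_mul_entropyUQs U hk, Finset.mul_sum,
    Real.rpow_sum_of_pos zero_lt_two]
  refine Finset.prod_le_prod (fun i _ => Nat.cast_nonneg _) fun i _ => ?_
  refine (card_typicalSet_fiber_le hε (hD i) (hk i) (f := fun a => a)
    (fun a b h => (Prod.mk.inj h).1) _).trans_eq ?_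
  congr 1
  ring

/-- The number of words jointly typical with `y` and with the same residues modulo `p ^ s` as `x₀`
is at most `2 ^ (n (1 + D ε) H(X | Y, [X]_s))`. -/
lemma card_jointlyTypical_fiber_le {p r n : ℕ} [NeZero p] {𝒴 : Type*} [Fintype 𝒴]
    {P : PMF (ZMod (p ^ r) × 𝒴)} {D ε : ℝ} (hε : 0 ≤ ε)
    (hD : ∀ z, P z ≠ 0 → 1 ≤ D * (P z).toReal) (hn : 0 < n) (s : ℕ)
    (x₀ : Fin n → ZMod (p ^ r)) (y : Fin n → 𝒴) :
    (Nat.card {x : Fin n → ZMod (p ^ r) // (fun j => (x j, y j)) ∈ typicalSet P ε n ∧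
      ∀ j, lowPart s (x j) = lowPart s (x₀ j)} : ℝ) ≤
      (2 : ℝ) ^ (n * (1 + D * ε) * entropyXYs P s) := by
  refine le_trans ?_ (card_typicalSet_fiber_le hε hD hn (f := fun z => z.1)
    (g := fun z => (z.2, lowPart s z.1))
    (fun _ _ h => Prod.ext (Prod.mk.inj h).1 (Prod.mk.inj (Prod.mk.inj h).2).1)
    (fun j => (y j, lowPart s (x₀ j))))
  refine Nat.cast_le.2 (Nat.card_le_card_of_injective
    (fun x => ⟨fun j => (x.1 j, y j), x.2.1, fun j => by simp [x.2.2 j]⟩) ?_)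
  intro x x' h
  refine Subtype.ext (funext fun j => ?_)
  exact (Prod.mk.inj (congrFun (Subtype.mk.inj h) j)).1

/-! ### Finite probabilities -/

lemma prob_eq_sum {α : Type*} [Fintype α] (J : PMF α) (E : Set α) :
    prob J E = ∑ a, E.indicator (fun a => (J a).toReal) a := by
  classical
  rw [prob, PMF.toOuterMeasure_apply_fintype, ENNReal.toReal_sum]
  · refine Finset.sum_congr rfl fun a _ => ?_
    by_cases h : a ∈ E <;> simp [h]
  · intro a _
    by_cases h : a ∈ E <;> simp [h, J.apply_ne_top a]

lemma prob_nonneg {α : Type*} (J : PMF α) (E : Set α) : 0 ≤ prob J E := ENNReal.toReal_nonneg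

lemma prob_mono {α : Type*} [Fintype α] (J : PMF α) {E F : Set α} (h : E ⊆ F) :
    prob J E ≤ prob J F := by
  rw [prob_eq_sum, prob_eq_sum]
  exact Finset.sum_le_sum fun a _ =>
    Set.indicator_le_indicator_of_subset h (fun _ => ENNReal.toReal_nonneg) a

lemma prob_univ {α : Type*} (J : PMF α) : prob J Set.univ = 1 := by
  rw [prob, (J.toOuterMeasure_apply_eq_one_iff _).2 (Set.subset_univ _), ENNReal.toReal_one]

lemma prob_iUnion_le {α ι : Type*} [Fintype α] (J : PMF α) (S : Finset ι) (E : ι → Set α) :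
    prob J {a | ∃ i ∈ S, a ∈ E i} ≤ ∑ i ∈ S, prob J (E i) := by
  classical
  simp only [prob_eq_sum]
  rw [Finset.sum_comm]
  refine Finset.sum_le_sum fun a _ => ?_
  have h0 : ∀ i ∈ S, 0 ≤ (E i).indicator (fun a => (J a).toReal) a := fun i _ =>
    Set.indicator_nonneg (fun _ _ => ENNReal.toReal_nonneg) a
  refine Set.indicator_apply_le' ?_ fun _ => Finset.sum_nonneg h0
  rintro ⟨i, hi, ha⟩
  refine le_trans ?_ (Finset.single_le_sum h0 hi)
  rw [Set.indicator_of_mem ha]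

lemma sum_prob_fiber {α β : Type*} [Fintype α] [Fintype β] (J : PMF α) (f : α → β) :
    ∑ b, prob J {a | f a = b} = 1 := by
  classical
  rw [← prob_univ J]
  simp only [prob_eq_sum]
  rw [Finset.sum_comm]
  refine Finset.sum_congr rfl fun a _ => ?_
  simp [Set.indicator_apply]

/-! ### Residues modulo powers of `p` -/

lemma lowPart_eq_iff {p r s : ℕ} [NeZero p] (hs : s ≤ r) (a b : ZMod (p ^ r)) :
    lowPart s a = lowPart s b ↔
      ZMod.castHom (pow_dvd_pow p hs) (ZMod (p ^ s)) a =
        ZMod.castHom (pow_dvd_pow p hs) (ZMod (p ^ s)) b := by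
  have hlt : ∀ a : ZMod (p ^ r), a.val % p ^ s < p ^ r := fun a =>
    (Nat.mod_lt _ (NeZero.pos _)).trans_le (Nat.pow_le_pow_right (NeZero.pos p) hs)
  have hcast : ∀ a : ZMod (p ^ r), ZMod.castHom (pow_dvd_pow p hs) (ZMod (p ^ s)) a =
      (a.val : ZMod (p ^ s)) := fun a => by
    rw [ZMod.castHom_apply, ZMod.natCast_val]
  rw [hcast, hcast, ZMod.natCast_eq_natCast_iff']
  constructor
  · intro h
    have := congrArg ZMod.val h
    rwa [lowPart, lowPart, ZMod.val_natCast_of_lt (hlt a), ZMod.val_natCast_of_lt (hlt b)] at this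
  · intro h
    rw [lowPart, lowPart, h]

lemma lowPart_self {p r : ℕ} [NeZero p] (a : ZMod (p ^ r)) : lowPart r a = a := by
  rw [lowPart, Nat.mod_eq_of_lt a.val_lt, ZMod.natCast_val, ZMod.cast_id]

lemma lowPart_codeword_eq {p r n m s : ℕ} [NeZero p] (hs : s ≤ r) {k : Fin m → ℕ}
    {u v : Inputs p r k} (h : ∀ i l, lowPart s (u i l) = lowPart s (v i l))
    (G : Generators p r n k) (b : Fin n → ZMod (p ^ r)) (j : Fin n) :
    lowPart s (codeword G b u j) = lowPart s (codeword G b v j) := by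
  simp only [lowPart_eq_iff hs] at h ⊢
  simp only [codeword, Pi.add_apply, Finset.sum_apply, Matrix.vecMul, dotProduct, map_add, map_sum,
    map_mul, h]

/-- If `a` and `b` differ modulo `p ^ (s + 1)`, then multiplication by `a - b` is injective on
`{0, …, p ^ (r - s) - 1}`. -/
lemma eq_of_sub_mul_eq {p r s : ℕ} [Fact p.Prime] (hs : s < r) {a b : ZMod (p ^ r)}
    (h : lowPart (s + 1) a ≠ lowPart (s + 1) b) {w w' : Fin (p ^ (r - s))}
    (hw : (a - b) * ((w : ℕ) : ZMod (p ^ r)) = (a - b) * ((w' : ℕ) : ZMod (p ^ r))) : w = w' := by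
  obtain ⟨d, hd⟩ := ZMod.intCast_surjective (a - b)
  have hnd : ¬ (p : ℤ) ^ (s + 1) ∣ d := by
    intro hdvd
    refine h ((lowPart_eq_iff hs a b).2 (sub_eq_zero.1 ?_))
    rw [← map_sub, ← hd, map_intCast, ZMod.intCast_zmod_eq_zero_iff_dvd]
    exact_mod_cast hdvd
  have hdvd : (p : ℤ) ^ (s + (r - s - 1) + 1) ∣ d * ((w : ℕ) - (w' : ℕ) : ℤ) := by
    have h0 : ((d * ((w : ℕ) - (w' : ℕ) : ℤ) : ℤ) : ZMod (p ^ r)) = 0 := by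
      push_cast
      rw [hd, mul_sub, hw, sub_self]
    rw [ZMod.intCast_zmod_eq_zero_iff_dvd] at h0
    have : s + (r - s - 1) + 1 = r := by omega
    rw [this]
    exact_mod_cast h0
  -- the exponent of `p` in `d` is at most `s`, so `p ^ (r - s)` divides `w - w'`
  have key : ∀ (t : ℕ) (c e : ℤ), ¬ (p : ℤ) ^ (t + 1) ∣ c → (p : ℤ) ^ (t + (r - s - 1) + 1) ∣ c * e →
      (p : ℤ) ^ (r - s) ∣ e := by
    have hp : Prime (p : ℤ) := Nat.prime_iff_prime_int.1 Fact.out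
    intro t
    induction t with
    | zero =>
      intro c e hc he
      refine hp.pow_dvd_of_dvd_mul_left _ (by simpa using hc) ?_
      have : 0 + (r - s - 1) + 1 = r - s := by omega
      rwa [this] at he
    | succ t ih =>
      intro c e hc he
      by_cases hpc : (p : ℤ) ∣ c
      · obtain ⟨c', rfl⟩ := hpc
        refine ih c' e (fun h => hc ?_) ?_
        · rw [pow_succ' _ (t + 1)]
          exact mul_dvd_mul_left _ h
        · have : t + 1 + (r - s - 1) + 1 = (t + (r - s - 1) + 1) + 1 := by omega
          rw [this, pow_succ', mul_assoc] at he
          exact (mul_dvd_mul_iff_left hp.ne_zero).1 he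
      · exact hp.pow_dvd_of_dvd_mul_left _ hpc ((pow_dvd_pow _ (by omega)).trans he)
  have hfin := key s d _ hnd hdvd
  have hmod : (w : ℕ) ≡ w' [MOD p ^ (r - s)] := by
    refine (Nat.modEq_iff_dvd.2 ?_).symm
    exact_mod_cast hfin
  exact Fin.ext (Nat.ModEq.eq_of_lt_of_lt hmod w.2 w'.2)

/-! ### Random codes -/

lemma codeword_sub_codeword {p r n m : ℕ} {k : Fin m → ℕ} (G : Generators p r n k)
    (b : Fin n → ZMod (p ^ r)) (u v : Inputs p r k) (j : Fin n) :
    codeword G b u j - codeword G b v j = ∑ i, ∑ l, (u i l - v i l) * G i l j := by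
  simp only [codeword, Pi.add_apply, Finset.sum_apply, Matrix.vecMul, dotProduct, sub_mul,
    Finset.sum_sub_distrib]
  ring

/-- The generator matrices that vanish outside row `l` of layer `i`, which is `w`. -/
def singleRow {p r n m : ℕ} {k : Fin m → ℕ} (i : Fin m) (l : Fin (k i))
    (w : Fin n → ZMod (p ^ r)) : Generators p r n k :=
  Pi.single i (Matrix.updateRow 0 l w)

lemma sum_mul_singleRow {p r n m : ℕ} {k : Fin m → ℕ} (i : Fin m) (l : Fin (k i))
    (w : Fin n → ZMod (p ^ r)) (d : Inputs p r k) (j : Fin n) :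
    ∑ i', ∑ l', d i' l' * singleRow (k := k) i l w i' l' j = d i l * w j := by
  rw [Finset.sum_eq_single i, Finset.sum_eq_single l]
  · simp [singleRow]
  · intro l' _ hl
    simp [singleRow, Matrix.updateRow_ne hl]
  · simp
  · intro i' _ hi
    simp [singleRow, Pi.single_eq_of_ne hi]
  · simp

/-- If the inputs `u` and `v` differ modulo `p ^ (s + 1)`, then among the codes that map `v` to `x₀`
at most a fraction `p ^ (-(r - s) n)` maps `u` to `x`: changing a row of the generators in which
`u - v` has a coordinate of valuation at most `s`, and correcting the translation, gives
`p ^ ((r - s) n)` codes with the same codeword of `v` and different codewords of `u`. -/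
lemma card_codes_mul_le {p r n m s : ℕ} [Fact p.Prime] (hs : s < r) {k : Fin m → ℕ}
    {u v : Inputs p r k} {i : Fin m} {l : Fin (k i)}
    (h : lowPart (s + 1) (u i l) ≠ lowPart (s + 1) (v i l)) (x₀ x : Fin n → ZMod (p ^ r)) :
    Nat.card {c : Generators p r n k × (Fin n → ZMod (p ^ r)) //
        codeword c.1 c.2 v = x₀ ∧ codeword c.1 c.2 u = x} * (p ^ (r - s)) ^ n ≤
      Nat.card {c : Generators p r n k × (Fin n → ZMod (p ^ r)) // codeword c.1 c.2 v = x₀} := by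
  have hW : (p ^ (r - s)) ^ n = Nat.card (Fin n → Fin (p ^ (r - s))) := by simp
  rw [hW, ← Nat.card_prod]
  let E : (Fin n → Fin (p ^ (r - s))) → Generators p r n k := fun w =>
    singleRow i l fun j => ((w j : ℕ) : ZMod (p ^ r))
  have hE : ∀ (G : Generators p r n k) (b) (z : Inputs p r k) (w) (j),
      codeword (G + E w) b z j = codeword G b z j + z i l * ((w j : ℕ) : ZMod (p ^ r)) := by
    intro G b z w j
    have := sum_mul_singleRow i l (fun j => ((w j : ℕ) : ZMod (p ^ r))) z j
    simp only [codeword, Pi.add_apply, Finset.sum_apply, Matrix.vecMul, dotProduct, Matrix.add_apply,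
      mul_add, Finset.sum_add_distrib]
    rw [← this]
    ring
  let F : {c : Generators p r n k × (Fin n → ZMod (p ^ r)) //
      codeword c.1 c.2 v = x₀ ∧ codeword c.1 c.2 u = x} × (Fin n → Fin (p ^ (r - s))) →
      {c : Generators p r n k × (Fin n → ZMod (p ^ r)) // codeword c.1 c.2 v = x₀} := fun c =>
    ⟨(c.1.1.1 + E c.2, c.1.1.2 - fun j => v i l * ((c.2 j : ℕ) : ZMod (p ^ r))), by
      funext j
      rw [← congrFun c.1.2.1 j]
      have := hE c.1.1.1 (c.1.1.2 - fun j => v i l * ((c.2 j : ℕ) : ZMod (p ^ r))) v c.2 j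
      rw [this]
      simp only [codeword, Pi.add_apply, Pi.sub_apply]
      ring⟩
  refine Nat.card_le_card_of_injective F ?_
  rintro ⟨⟨⟨G, b⟩, hv, hu⟩, w⟩ ⟨⟨⟨G', b'⟩, hv', hu'⟩, w'⟩ hF
  obtain ⟨hG, hb⟩ := Prod.mk.inj (Subtype.mk.inj hF)
  dsimp only at hG hb hv hu hv' hu'
  -- the difference of the two codewords determines the new row
  have hww : w = w' := by
    funext j
    refine eq_of_sub_mul_eq hs h ?_
    have e1 := codeword_sub_codeword (G + E w) b u v j
    have e2 := codeword_sub_codeword (G' + E w') b' u v j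
    rw [hE, hE, hv, hu] at e1
    rw [hE, hE, hv', hu', ← hG, ← e1] at e2
    linear_combination -e2
  subst hww
  have hGG : G = G' := add_right_cancel hG
  have hbb : b = b' := sub_left_injective hb
  subst hGG hbb
  rfl

/-! ### One competing codeword -/

section Transmission

variable {p r n m : ℕ} [Fact p.Prime] {k : Fin m → ℕ} {𝒴 : Type*} [Fintype 𝒴]
  {U : Fin m → PMF (ZMod (p ^ r))} {P : PMF (ZMod (p ^ r) × 𝒴)} {ε : ℝ} {u₀ : Inputs p r k}
  {J : PMF (Outcome p r n k 𝒴)}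

lemma IsTransmission.prob_code (hJ : IsTransmission U P ε u₀ J)
    (A : Generators p r n k × (Fin n → ZMod (p ^ r)) → Prop) :
    prob J {ω | A ω.1} = (Nat.card {c // A c} : ℝ) /
      Fintype.card (Generators p r n k × (Fin n → ZMod (p ^ r))) := by
  classical
  have h : prob J {ω | A ω.1} = prob (J.map Prod.fst) {c | A c} := by
    rw [prob, prob, PMF.toOuterMeasure_map_apply]
    rfl
  rw [h, hJ.uniform, prob, PMF.toOuterMeasure_uniformOfFintype_apply, ENNReal.toReal_div,
    ENNReal.toReal_natCast, ENNReal.toReal_natCast, Nat.card_eq_fintype_card]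
  rfl

/-- The joint law of the sent codeword, another codeword and the output, bounded by the law of the
sent codeword and the output. -/
lemma IsTransmission.prob_triple_le (hJ : IsTransmission U P ε u₀ J) {s : ℕ} (hs : s < r)
    {u : Inputs p r k} (hu : u ∈ inputSet U ε k) {i : Fin m} {l : Fin (k i)}
    (h : lowPart (s + 1) (u i l) ≠ lowPart (s + 1) (u₀ i l)) (x₀ x : Fin n → ZMod (p ^ r))
    (y : Fin n → 𝒴) :
    prob J {ω | randCodeword u₀ ω = x₀ ∧ randCodeword u ω = x ∧ ω.2 = y} * ((p : ℝ) ^ (r - s)) ^ n ≤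
      prob J {ω | randCodeword u₀ ω = x₀ ∧ ω.2 = y} := by
  have hne : u ≠ u₀ := by
    rintro rfl
    exact h rfl
  have hind := hJ.indep u hu hne x₀ x y
  have hpair : prob J {ω | randCodeword u₀ ω = x₀ ∧ randCodeword u ω = x} *
      ((p : ℝ) ^ (r - s)) ^ n ≤ prob J {ω | randCodeword u₀ ω = x₀} := by
    have hcard := card_codes_mul_le hs h x₀ x
    have e1 := hJ.prob_code fun c => codeword c.1 c.2 u₀ = x₀ ∧ codeword c.1 c.2 u = x
    have e2 := hJ.prob_code fun c => codeword c.1 c.2 u₀ = x₀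
    unfold randCodeword
    rw [e1, e2, div_mul_eq_mul_div]
    gcongr
    exact_mod_cast hcard
  rcases (prob_nonneg J {ω | randCodeword u₀ ω = x₀}).eq_or_lt with h0 | hpos
  · have hle := prob_mono J (E := {ω | randCodeword u₀ ω = x₀ ∧ randCodeword u ω = x ∧ ω.2 = y})
      (F := {ω | randCodeword u₀ ω = x₀}) fun ω hω => hω.1
    rw [(hle.trans_eq h0.symm).antisymm (prob_nonneg _ _), zero_mul]
    exact prob_nonneg _ _
  · refine le_of_mul_le_mul_right ?_ hpos
    calc _ = prob J {ω | randCodeword u₀ ω = x₀ ∧ randCodeword u ω = x ∧ ω.2 = y} *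
          prob J {ω | randCodeword u₀ ω = x₀} * ((p : ℝ) ^ (r - s)) ^ n := by ring
      _ = prob J {ω | randCodeword u₀ ω = x₀ ∧ randCodeword u ω = x} * ((p : ℝ) ^ (r - s)) ^ n *
          prob J {ω | randCodeword u₀ ω = x₀ ∧ ω.2 = y} := by rw [hind]; ring
      _ ≤ prob J {ω | randCodeword u₀ ω = x₀} * prob J {ω | randCodeword u₀ ω = x₀ ∧ ω.2 = y} :=
          mul_le_mul_of_nonneg_right hpair (prob_nonneg _ _)
      _ = _ := mul_comm _ _

/-- The probability that the codeword of a given input `u`, which agrees with the sent input `u₀`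
modulo `p ^ s` but not modulo `p ^ (s + 1)`, is jointly typical with the output. -/
lemma IsTransmission.prob_jointlyTypical_le (hJ : IsTransmission U P ε u₀ J) {D : ℝ} (hε : 0 ≤ ε)
    (hD : ∀ z, P z ≠ 0 → 1 ≤ D * (P z).toReal) (hn : 0 < n) {s : ℕ} (hs : s < r)
    {u : Inputs p r k} (hu : u ∈ inputSet U ε k)
    (hlow : ∀ i l, lowPart s (u i l) = lowPart s (u₀ i l))
    (h : ¬ ∀ i l, lowPart (s + 1) (u i l) = lowPart (s + 1) (u₀ i l)) :
    prob J {ω | (fun j => (randCodeword u ω j, ω.2 j)) ∈ typicalSet P ε n} ≤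
      (2 : ℝ) ^ (n * (1 + D * ε) * entropyXYs P s) / ((p : ℝ) ^ (r - s)) ^ n := by
  classical
  push Not at h
  obtain ⟨i, l, hil⟩ := h
  have hp : (0 : ℝ) < p := by exact_mod_cast (Fact.out : p.Prime).pos
  set q : ℝ := ((p : ℝ) ^ (r - s)) ^ n with hq
  have hq0 : 0 < q := by positivity
  let T : (Fin n → ZMod (p ^ r)) × (Fin n → 𝒴) → Finset (Fin n → ZMod (p ^ r)) := fun z =>
    Finset.univ.filter fun x => (fun j => (x j, z.2 j)) ∈ typicalSet P ε n ∧
      ∀ j, lowPart s (x j) = lowPart s (z.1 j)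
  have hcover : {ω : Outcome p r n k 𝒴 |
      (fun j => (randCodeword u ω j, ω.2 j)) ∈ typicalSet P ε n} ⊆
      {ω | ∃ t ∈ Finset.univ.sigma T, ω ∈ {ω : Outcome p r n k 𝒴 |
        randCodeword u₀ ω = t.1.1 ∧ randCodeword u ω = t.2 ∧ ω.2 = t.1.2}} := by
    intro ω hω
    refine ⟨⟨(randCodeword u₀ ω, ω.2), randCodeword u ω⟩, ?_, rfl, rfl, rfl⟩
    simp only [Finset.mem_sigma, Finset.mem_univ, true_and, T, Finset.mem_filter]
    exact ⟨hω, fun j => lowPart_codeword_eq hs.le hlow _ _ j⟩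
  refine (prob_mono J hcover).trans ((prob_iUnion_le J _ _).trans ?_)
  rw [Finset.sum_sigma]
  calc _ ≤ ∑ z : (Fin n → ZMod (p ^ r)) × (Fin n → 𝒴),
        prob J {ω | (randCodeword u₀ ω, ω.2) = z} *
          ((2 : ℝ) ^ (n * (1 + D * ε) * entropyXYs P s) / q) := by
        refine Finset.sum_le_sum fun z _ => ?_
        have hz : {ω : Outcome p r n k 𝒴 | (randCodeword u₀ ω, ω.2) = z} =
            {ω | randCodeword u₀ ω = z.1 ∧ ω.2 = z.2} := by
          ext ω
          simp [Prod.ext_iff]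
        have hT : ((T z).card : ℝ) ≤ (2 : ℝ) ^ (n * (1 + D * ε) * entropyXYs P s) := by
          have := card_jointlyTypical_fiber_le hε hD hn s z.1 z.2
          rwa [Nat.card_eq_fintype_card, Fintype.card_subtype] at this
        rw [hz]
        calc _ ≤ ∑ x ∈ T z, prob J {ω | randCodeword u₀ ω = z.1 ∧ ω.2 = z.2} / q :=
              Finset.sum_le_sum fun x _ =>
                (le_div_iff₀ hq0).2 (hJ.prob_triple_le hs hu hil z.1 x z.2)
          _ = prob J {ω | randCodeword u₀ ω = z.1 ∧ ω.2 = z.2} * ((T z).card / q) := by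
              rw [Finset.sum_const, nsmul_eq_mul]
              ring
          _ ≤ _ := by
              refine mul_le_mul_of_nonneg_left ?_ (prob_nonneg _ _)
              gcongr
    _ = _ := by rw [← Finset.sum_mul, sum_prob_fiber, one_mul]

end Transmission

/-! ### Competing inputs -/

/-- The inputs of the code that agree with `u₀` modulo `p ^ s` but not modulo `p ^ (s + 1)`. -/
noncomputable def competitors {p r m : ℕ} [NeZero p] {k : Fin m → ℕ}
    (U : Fin m → PMF (ZMod (p ^ r))) (ε : ℝ) (u₀ : Inputs p r k) (s : ℕ) :
    Finset (Inputs p r k) :=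
  open Classical in Finset.univ.filter fun u => u ∈ inputSet U ε k ∧
    (∀ i l, lowPart s (u i l) = lowPart s (u₀ i l)) ∧
    ¬ ∀ i l, lowPart (s + 1) (u i l) = lowPart (s + 1) (u₀ i l)

lemma mem_competitors {p r m : ℕ} [NeZero p] {k : Fin m → ℕ} {U : Fin m → PMF (ZMod (p ^ r))}
    {ε : ℝ} {u₀ u : Inputs p r k} {s : ℕ} :
    u ∈ competitors U ε u₀ s ↔ u ∈ inputSet U ε k ∧
      (∀ i l, lowPart s (u i l) = lowPart s (u₀ i l)) ∧
      ¬ ∀ i l, lowPart (s + 1) (u i l) = lowPart (s + 1) (u₀ i l) := by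
  simp [competitors]

lemma exists_mem_competitors {p r m : ℕ} [NeZero p] {k : Fin m → ℕ}
    {U : Fin m → PMF (ZMod (p ^ r))} {ε : ℝ} {u₀ u : Inputs p r k} (hu : u ∈ inputSet U ε k)
    (hne : u ≠ u₀) : ∃ s < r, u ∈ competitors U ε u₀ s := by
  by_contra! hcon
  have key : ∀ s ≤ r, ∀ i l, lowPart s (u i l) = lowPart s (u₀ i l) := by
    intro s
    induction s with
    | zero => intro _ i l; rw [lowPart_zero, lowPart_zero]
    | succ s ih =>
      intro hs
      by_contra h
      exact hcon s hs (mem_competitors.2 ⟨hu, ih (Nat.le_of_succ_le hs), h⟩)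
  refine hne (funext fun i => funext fun l => ?_)
  have := key r le_rfl i l
  rwa [lowPart_self, lowPart_self] at this

/-- The sent input itself is counted in the bound, so a level without entropy has no competitors. -/
lemma card_competitors_add_one_le {p r m : ℕ} [NeZero p] {U : Fin m → PMF (ZMod (p ^ r))}
    {D ε : ℝ} (hε : 0 ≤ ε) (hD : ∀ i a, U i a ≠ 0 → 1 ≤ D * (U i a).toReal) {k : Fin m → ℕ}
    (hk : ∀ i, 0 < k i) {u₀ : Inputs p r k} (hu₀ : u₀ ∈ inputSet U ε k) (s : ℕ) :
    ((competitors U ε u₀ s).card : ℝ) + 1 ≤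
      (2 : ℝ) ^ ((1 + D * ε) * ((∑ i, k i : ℕ) * entropyUQs U k s)) := by
  classical
  refine le_trans ?_ (card_inputSet_fiber_le hε hD hk s u₀)
  have hnot : u₀ ∉ competitors U ε u₀ s := fun h => (mem_competitors.1 h).2.2 fun _ _ => rfl
  rw [← Nat.cast_add_one, ← Finset.card_insert_of_notMem hnot, Nat.card_eq_fintype_card,
    Fintype.card_subtype]
  refine Nat.cast_le.2 (Finset.card_le_card fun u hu => ?_)
  rcases Finset.mem_insert.1 hu with rfl | hu
  · simp [hu₀]
  · obtain ⟨h1, h2, -⟩ := mem_competitors.1 hu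
    simp [h1, h2]

section Transmission

variable {p r n m : ℕ} [Fact p.Prime] {k : Fin m → ℕ} {𝒴 : Type*} [Fintype 𝒴]
  {U : Fin m → PMF (ZMod (p ^ r))} {P : PMF (ZMod (p ^ r) × 𝒴)} {ε : ℝ} {u₀ : Inputs p r k}
  {J : PMF (Outcome p r n k 𝒴)}

/-- The total probability of confusion with the inputs at one residue level decays like
`2 ^ (-n σ)`, if the level is empty for lack of entropy or has slack `2 σ`. -/
lemma IsTransmission.sum_competitors_le (hJ : IsTransmission U P ε u₀ J) {D σ : ℝ} (hε : 0 ≤ ε)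
    (hD0 : 0 ≤ D) (hDU : ∀ i a, U i a ≠ 0 → 1 ≤ D * (U i a).toReal)
    (hDP : ∀ z, P z ≠ 0 → 1 ≤ D * (P z).toReal) (hn : 0 < n) (hk : ∀ i, 0 < k i)
    (hu₀ : u₀ ∈ inputSet U ε k) (hσ : 0 ≤ σ) {s : ℕ} (hs : s < r)
    (hslack : entropyUQs U k s ≠ 0 → (∑ i, k i : ℕ) * entropyUQs U k s ≤
      n * (Real.logb 2 ((p : ℝ) ^ (r - s)) - entropyXYs P s - 2 * σ))
    (hsmall : D * ε * Real.logb 2 ((p : ℝ) ^ (r - s)) ≤ σ) :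
    ∑ u ∈ competitors U ε u₀ s,
      prob J {ω | (fun j => (randCodeword u ω j, ω.2 j)) ∈ typicalSet P ε n} ≤
      (2 : ℝ) ^ (-(n * σ)) := by
  have hp : (0 : ℝ) < p := by exact_mod_cast (Fact.out : p.Prime).pos
  have hcard := card_competitors_add_one_le hε hDU hk hu₀ s
  by_cases h0 : entropyUQs U k s = 0
  · have hempty : competitors U ε u₀ s = ∅ := by
      rw [h0, mul_zero, mul_zero, Real.rpow_zero] at hcard
      have : ((competitors U ε u₀ s).card : ℝ) ≤ 0 := by linarith
      exact Finset.card_eq_zero.1 (by exact_mod_cast this.antisymm (Nat.cast_nonneg _))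
    rw [hempty, Finset.sum_empty]
    positivity
  set Λ := Real.logb 2 ((p : ℝ) ^ (r - s)) with hΛ
  have hq : ((p : ℝ) ^ (r - s)) ^ n = (2 : ℝ) ^ (n * Λ) := by
    rw [mul_comm, Real.rpow_mul zero_le_two, Real.rpow_logb two_pos (by norm_num) (by positivity),
      Real.rpow_natCast]
  have hbound : ∀ u ∈ competitors U ε u₀ s,
      prob J {ω | (fun j => (randCodeword u ω j, ω.2 j)) ∈ typicalSet P ε n} ≤
      (2 : ℝ) ^ (n * (1 + D * ε) * entropyXYs P s - n * Λ) := by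
    intro u hu
    obtain ⟨h1, h2, h3⟩ := mem_competitors.1 hu
    rw [Real.rpow_sub two_pos, ← hq]
    exact hJ.prob_jointlyTypical_le hε hDP hn hs h1 h2 h3
  refine (Finset.sum_le_card_nsmul _ _ _ hbound).trans ?_
  rw [nsmul_eq_mul]
  refine (mul_le_mul_of_nonneg_right ((le_add_of_nonneg_right zero_le_one).trans hcard)
    (by positivity)).trans ?_
  rw [← Real.rpow_add two_pos]
  refine Real.rpow_le_rpow_of_exponent_le one_le_two ?_
  have hDε : 0 ≤ D * ε := mul_nonneg hD0 hε
  have h1 := mul_le_mul_of_nonneg_left (hslack h0) (by linarith : 0 ≤ 1 + D * ε)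
  have h2 := mul_le_mul_of_nonneg_left hsmall (Nat.cast_nonneg n : (0 : ℝ) ≤ n)
  have h3 : 0 ≤ D * ε * (n * σ) := by positivity
  nlinarith

/-- Union bound over the inputs other than the sent one, grouped by residue level. -/
lemma IsTransmission.prob_confusionEvent_le (hJ : IsTransmission U P ε u₀ J) {B : ℝ}
    (hB : ∀ s < r, ∑ u ∈ competitors U ε u₀ s,
      prob J {ω | (fun j => (randCodeword u ω j, ω.2 j)) ∈ typicalSet P ε n} ≤ B) :
    prob J (confusionEvent U P ε u₀) ≤ r * B := by
  have hcover : (confusionEvent U P ε u₀ : Set (Outcome p r n k 𝒴)) ⊆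
      {ω | ∃ t ∈ (Finset.range r).sigma (competitors U ε u₀), ω ∈ {ω : Outcome p r n k 𝒴 |
        (fun j => (randCodeword t.2 ω j, ω.2 j)) ∈ typicalSet P ε n}} := by
    rintro ω ⟨x, ⟨u, hu, rfl⟩, htyp, hne⟩
    obtain ⟨s, hs, hmem⟩ := exists_mem_competitors (u₀ := u₀) hu (by rintro rfl; exact hne rfl)
    exact ⟨⟨s, u⟩, Finset.mem_sigma.2 ⟨Finset.mem_range.2 hs, hmem⟩, htyp⟩
  refine (prob_mono J hcover).trans ((prob_iUnion_le J _ _).trans ?_)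
  rw [Finset.sum_sigma]
  refine (Finset.sum_le_card_nsmul _ _ B fun s hs => hB s (Finset.mem_range.1 hs)).trans ?_
  rw [Finset.card_range, nsmul_eq_mul]

end Transmission

/-! ### Slack in the rate condition -/

/-- The rate condition at a residue level leaves a slack that does not depend on the ratio `h / H`
of the entropies, although that ratio may be arbitrarily small. -/
lemma rate_slack {H h R L Λ δ : ℝ} (hH : 0 < H) (hh : 0 < h) (hR : 0 ≤ R) (hRΛ : R ≤ Λ)
    (hδ : 0 < δ) (hL : R + δ ≤ H / h * L) :
    0 < L ∧ R * (h / H) ≤ L - L * (δ / (Λ + δ)) := by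
  have hρ : 0 < h / H := by positivity
  have hL' : h / H * (R + δ) ≤ L := by
    have := mul_le_mul_of_nonneg_left hL hρ.le
    rwa [← mul_assoc, div_mul_div_comm, mul_comm h H, div_self (by positivity), one_mul] at this
  have hΛδ : 0 < Λ + δ := by linarith
  refine ⟨lt_of_lt_of_le (by positivity) hL', ?_⟩
  have e : L - L * (δ / (Λ + δ)) = L * Λ / (Λ + δ) := by
    field_simp
    ring
  rw [e, le_div_iff₀ hΛδ]
  have h1 := mul_le_mul_of_nonneg_right hL' (hR.trans hRΛ)
  have h2 := mul_le_mul_of_nonneg_left hRΛ (mul_pos hρ hδ).le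
  nlinarith

lemma exists_common_lower_bound (L : ℕ → ℝ) (r : ℕ) :
    ∃ σ > 0, ∀ s < r, 0 < L s → σ ≤ L s := by
  induction r with
  | zero => exact ⟨1, one_pos, by simp⟩
  | succ r ih =>
    obtain ⟨σ, hσ, h⟩ := ih
    by_cases hr : 0 < L r
    · refine ⟨min σ (L r), lt_min hσ hr, fun s hs hpos => ?_⟩
      rcases Nat.lt_succ_iff_lt_or_eq.1 hs with hs | rfl
      · exact (min_le_left _ _).trans (h s hs hpos)
      · exact min_le_right _ _
    · refine ⟨σ, hσ, fun s hs hpos => ?_⟩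
      rcases Nat.lt_succ_iff_lt_or_eq.1 hs with hs | rfl
      · exact h s hs hpos
      · exact absurd hpos hr

/-- The rate condition gives a linear slack at every residue level that carries entropy. -/
lemma exists_linear_slack {p r m : ℕ} [Fact p.Prime] {𝒴 : Type*} [Fintype 𝒴]
    (U : Fin m → PMF (ZMod (p ^ r))) (P : PMF (ZMod (p ^ r) × 𝒴)) {δ : ℝ} (hδ : 0 < δ) :
    ∃ σ > 0, ∀ (k : Fin m → ℕ) (n : ℕ), 0 < n →
      (∀ s < r, entropyUQs U k s ≠ 0 → rate U k n + δ ≤ entropyUQ U k / entropyUQs U k s *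
        (Real.logb 2 ((p : ℝ) ^ (r - s)) - entropyXYs P s)) →
      ∀ s < r, entropyUQs U k s ≠ 0 → (∑ i, k i : ℕ) * entropyUQs U k s ≤
        n * (Real.logb 2 ((p : ℝ) ^ (r - s)) - entropyXYs P s - 2 * σ) := by
  have hp1 : (1 : ℝ) ≤ p := by exact_mod_cast (Fact.out : p.Prime).one_le
  set Λ := Real.logb 2 ((p : ℝ) ^ r) with hΛ
  have hΛ0 : 0 ≤ Λ := Real.logb_nonneg one_lt_two (one_le_pow₀ hp1)
  obtain ⟨σ, hσ, hσL⟩ := exists_common_lower_bound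
    (fun s => Real.logb 2 ((p : ℝ) ^ (r - s)) - entropyXYs P s) r
  refine ⟨σ * (δ / (Λ + δ)) / 2, by positivity, fun k n hn hR s hs hs0 => ?_⟩
  have hn' : (0 : ℝ) < n := by exact_mod_cast hn
  have hrate : 0 ≤ rate U k n := by
    have := entropyUQ_nonneg U k
    unfold rate
    positivity
  have hh : 0 < entropyUQs U k s := (entropyUQs_nonneg U k s).lt_of_ne' hs0
  have hH : 0 < entropyUQ U k := by
    refine (entropyUQ_nonneg U k).lt_of_ne' fun hH0 => ?_
    have := hR s hs hs0
    rw [hH0, zero_div, zero_mul] at this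
    linarith
  -- the condition at level `0` bounds the rate by the capacity, hence by `log₂ (p ^ r)`
  have hRΛ : rate U k n ≤ Λ := by
    have := hR 0 (by omega) (by rw [entropyUQs_zero]; exact hH.ne')
    rw [entropyUQs_zero, div_self hH.ne', one_mul, Nat.sub_zero] at this
    linarith [entropyXYs_nonneg P 0]
  obtain ⟨hLpos, hL⟩ := rate_slack hH hh hrate hRΛ hδ (hR s hs hs0)
  have hfrac : 0 ≤ δ / (Λ + δ) := by positivity
  have hmin := mul_le_mul_of_nonneg_right (hσL s hs hLpos) hfrac
  have hk : ((∑ i, k i : ℕ) : ℝ) * entropyUQs U k s =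
      n * (rate U k n * (entropyUQs U k s / entropyUQ U k)) := by
    unfold rate
    field_simp
  rw [hk]
  refine mul_le_mul_of_nonneg_left ?_ hn'.le
  linarith

/-! ### Vanishing confusion probability -/

theorem lemma2 {p r m : ℕ} [Fact p.Prime] (hr : 1 ≤ r) (hm : 1 ≤ m) {𝒴 : Type*} [Fintype 𝒴]
    (U : Fin m → PMF (ZMod (p ^ r)))
    (P : PMF (ZMod (p ^ r) × 𝒴))
    (hX : P.map Prod.fst = PMF.uniformOfFintype (ZMod (p ^ r)))
    (k : ℕ → Fin m → ℕ) (hk : ∀ n i, 0 < k n i)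
    (hR : ∃ δ > 0, ∀ᶠ n in atTop, ∀ s < r, entropyUQs U (k n) s ≠ 0 →
      rate U (k n) n + δ ≤ entropyUQ U (k n) / entropyUQs U (k n) s *
        (Real.logb 2 ((p : ℝ) ^ (r - s)) - entropyXYs P s)) :
    ∃ ε₀ > 0, ∀ ε, 0 < ε → ε < ε₀ → ∀ η > 0, ∀ᶠ n in atTop,
      ∀ u₀ ∈ inputSet U ε (k n), ∀ J : PMF (Outcome p r n (k n) 𝒴),
        IsTransmission U P ε u₀ J → prob J (confusionEvent U P ε u₀) ≤ η := by
  obtain ⟨δ, hδ, hR⟩ := hR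
  obtain ⟨σ, hσ, hslack⟩ := exists_linear_slack U P hδ
  obtain ⟨D, hD0, hDU, hDP⟩ := exists_uniform_mass_bound U P
  have hp1 : (1 : ℝ) ≤ p := by exact_mod_cast (Fact.out : p.Prime).one_le
  set Λ := Real.logb 2 ((p : ℝ) ^ r) with hΛ
  have hΛ0 : 0 ≤ Λ := Real.logb_nonneg one_lt_two (one_le_pow₀ hp1)
  refine ⟨σ / (D * Λ + 1), by positivity, fun ε hε hεlt η hη => ?_⟩
  have hsmall : ∀ s, D * ε * Real.logb 2 ((p : ℝ) ^ (r - s)) ≤ σ := by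
    intro s
    have h1 : Real.logb 2 ((p : ℝ) ^ (r - s)) ≤ Λ :=
      Real.logb_le_logb_of_le one_lt_two (by positivity) (pow_le_pow_right₀ hp1 (Nat.sub_le r s))
    have h2 := (lt_div_iff₀ (by positivity)).1 hεlt
    have h3 := mul_le_mul_of_nonneg_left h1 (mul_nonneg hD0 hε.le)
    nlinarith
  have hlim : Tendsto (fun n : ℕ => (r : ℝ) * (2 : ℝ) ^ (-(n * σ))) atTop (nhds 0) := by
    have h := tendsto_pow_atTop_nhds_zero_of_lt_one (r := (2 : ℝ) ^ (-σ)) (by positivity)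
      (Real.rpow_lt_one_of_one_lt_of_neg one_lt_two (by linarith))
    have h' := h.const_mul (r : ℝ)
    rw [mul_zero] at h'
    refine h'.congr fun n => ?_
    rw [← Real.rpow_natCast, ← Real.rpow_mul zero_le_two]
    congr 2
    ring
  filter_upwards [hR, eventually_gt_atTop 0, hlim.eventually_le_const hη] with n hRn hn hηn
  intro u₀ hu₀ J hJ
  refine (hJ.prob_confusionEvent_le fun s hs => ?_).trans hηn
  exact hJ.sum_competitors_le hε.le hD0 hDU hDP hn (hk n) hu₀ hσ.le hs
    (hslack (k n) n hn hRn s hs) (hsmall s)
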